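/- Consider the equivalence class sorting problem on a finite set $S$ of $n$ elements: an unknown equivalence relation $r$ on $S$ has to be determined, and the only access to $r$ is through tests of the form "is $x$ equivalent to $y$?". In the exclusive-read (ER) version of Valiant's parallel comparison model with $n$ processors, an algorithm proceeds in rounds. In each round it performs simultaneously at most $n$ tests, each between two different elements, such that every element takes part in at most one test of the round; the choice of the tests may depend on the answers obtained in earlier rounds and, for a randomized algorithm, on a random seed. Only rounds of tests are counted. Theorem. For every constant $\lambda\in(0,0.4]$ there is a number $R$ that depends only on $\lambda$, such that for every finite set $S$, with $n=|S|$, there is a randomized ER algorithm with $n$ processors that never uses more than $R$ rounds and has the following property: with probability at least $1-e^{-n}$ over the random seed, the algorithm correctly outputs the partition of $S$ into equivalence classes for every equivalence relation on $S$ whose smallest equivalence class has at least $\lambda n$ elements (simultaneously for all such relations). -/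

import Mathlib

namespace ECS

universe u

/-- A deterministic algorithm in Valiant's parallel comparison model on the element set `S`.
It either stops and outputs an equivalence relation, or performs a round: a finite set `Q` of
equivalence tests (one for each pair in `Q`), all carried out at once, after which it continues
in a way that may depend on the answers to these tests (and, through the position in the tree,
on all earlier answers). Only tests give information about the input, and computation between
rounds is free. -/
inductive Algorithm (S : Type u) : Type u where
  | output (answer : Setoid S) : Algorithm S
  | round (Q : Finset (S × S)) (next : ({q : S × S // q ∈ Q} → Bool) → Algorithm S) : Algorithm S

namespace Algorithm

variable {S : Type u}

open Classical in
/-- The output of the algorithm when the unknown equivalence relation is `r`. -/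
noncomputable def run (r : Setoid S) : Algorithm S → Setoid S
  | output a => a
  | round _ next => run r (next fun q => decide (r q.1.1 q.1.2))

open Classical in
/-- The number of rounds performed when the unknown equivalence relation is `r`. -/
noncomputable def rounds (r : Setoid S) : Algorithm S → ℕ
  | output _ => 0
  | round _ next => rounds r (next fun q => decide (r q.1.1 q.1.2)) + 1

/-- A round of the exclusive-read version with `p` processors: at most `p` tests, each of them
between two different elements, and each element takes part in at most one test. -/
def IsExclusiveRound (p : ℕ) (Q : Finset (S × S)) : Prop :=
  Q.card ≤ p ∧ (∀ q ∈ Q, q.1 ≠ q.2) ∧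
    ∀ q ∈ Q, ∀ q' ∈ Q, ∀ x : S, (x = q.1 ∨ x = q.2) → (x = q'.1 ∨ x = q'.2) → q = q'

/-- All rounds of the algorithm are exclusive-read rounds with `p` processors. -/
def IsExclusiveRead (p : ℕ) : Algorithm S → Prop
  | output _ => True
  | round Q next => IsExclusiveRound p Q ∧ ∀ answers, IsExclusiveRead p (next answers)

/-- The algorithm sorts the elements into their equivalence classes on input `r`. -/
def Sorts (A : Algorithm S) (r : Setoid S) : Prop :=
  A.run r = r

end Algorithm

/-- A randomized algorithm draws a random seed before the first round and then runs the
deterministic algorithm that belongs to this seed. -/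
structure RandomizedAlgorithm (S : Type u) where
  Seed : Type u
  law : PMF Seed
  algorithm : Seed → Algorithm S

/-- Every equivalence class of `r` (equivalently, the smallest one) has at least `a` elements. -/
def SmallestClassAtLeast {S : Type u} (r : Setoid S) (a : ℝ) : Prop :=
  ∀ c ∈ r.classes, a ≤ (c.ncard : ℝ)

end ECS

/-!
The algorithm has two nonadaptive phases. The seed is a tuple of `d` independent uniform permutations
of `S`, with `d` depending only on `lam`. In the first phase every `x` is tested against `π x`,
for every permutation `π` of the tuple; since the graph of a permutation has maximal degree two, three
exclusive-read rounds suffice per permutation (`exists_rounds_of_perm`). The positive answers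
generate an equivalence relation `s` finer than the unknown one. In the second phase every element
is tested against some member of every class `C` of `s` with `n ≤ K * |C|`, where `K = ⌈3 / lam⌉`;
there are at most `K` such classes, and `K` rounds suffice for each, because the work can be
distributed evenly over the members of `C` (`exists_rounds_of_setoid`). The algorithm outputs the
equivalence relation generated by all positive answers.

It is correct on `r` as soon as every class of `r` contains a class of `s` that is large in the sense
above. This holds for all admissible `r` at once if the permutations are *expanding*: any two sets `A`,
`B` with at least `lam * n / 3` elements each are joined by some edge `x ↦ π x` from `A` to `B`. Indeed, in
a class `W` of `r`, take a smallest union `U` of classes of `s` with `|U| ≥ |W| / 3`. If a class inside `U` had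
fewer than `|W| / 3` elements, then `|U| < 2 |W| / 3` by minimality, so that `U` and `W \ U` would both be
large, and an edge between them would merge two classes of `s` (`exists_large_class`).

A uniform permutation maps `A` off `B` with probability at most `(1 - |B| / n) ^ |A|`
(`card_avoiding_mul_le`), which is at most `exp (-ε² n)` with `ε = lam / 3`. The `d` permutations are
independent and there are at most `4 ^ n` pairs `(A, B)`, so for `d ≥ 3 / ε²` the permutations fail to be
expanding with probability at most `4 ^ n * exp (-3 n) ≤ exp (-n)` (`card_not_expanding_le`).
-/

namespace ECS

open Finset

/-! ### Nonadaptive phases -/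

namespace Algorithm

variable {S : Type*}

open Classical in
/-- Performs the rounds of a list one after the other and then continues with `k`, which is given the
answers as a function on all pairs. The function `a` holds the answers collected so far, and
untested pairs keep their value under `a`. -/
noncomputable def performRounds (k : (S × S → Bool) → Algorithm S) :
    List (Finset (S × S)) → (S × S → Bool) → Algorithm S
  | [], a => k a
  | Q :: L, a => round Q fun ans =>
      performRounds k L fun p => if h : p ∈ Q then ans ⟨p, h⟩ else a p

open Classical in
/-- The answers collected by the rounds of `L` on input `r`, in addition to earlier answers `a`. -/
noncomputable def answersFrom (r : Setoid S) :
    List (Finset (S × S)) → (S × S → Bool) → S × S → Bool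
  | [], a => a
  | Q :: L, a => answersFrom r L fun p => if p ∈ Q then decide (r p.1 p.2) else a p

theorem run_performRounds (r : Setoid S) (k : (S × S → Bool) → Algorithm S)
    (L : List (Finset (S × S))) (a : S × S → Bool) :
    (performRounds k L a).run r = (k (answersFrom r L a)).run r := by
  induction L generalizing a with
  | nil => rfl
  | cons Q L ih =>
    simp only [performRounds, run, answersFrom, ih]
    rfl

theorem rounds_performRounds (r : Setoid S) (k : (S × S → Bool) → Algorithm S)
    (L : List (Finset (S × S))) (a : S × S → Bool) :
    (performRounds k L a).rounds r = (k (answersFrom r L a)).rounds r + L.length := by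
  induction L generalizing a with
  | nil => rfl
  | cons Q L ih =>
    simp only [performRounds, rounds, answersFrom, ih, List.length_cons, add_assoc]
    rfl

theorem isExclusiveRead_performRounds {p : ℕ} {k : (S × S → Bool) → Algorithm S}
    (hk : ∀ a, (k a).IsExclusiveRead p) {L : List (Finset (S × S))}
    (hL : ∀ Q ∈ L, IsExclusiveRound p Q) (a : S × S → Bool) :
    (performRounds k L a).IsExclusiveRead p := by
  induction L generalizing a with
  | nil => exact hk a
  | cons Q L ih =>
    exact ⟨hL Q (by simp), fun ans => ih (fun Q' h => hL Q' (by simp [h])) _⟩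

theorem answersFrom_eq_true_iff (r : Setoid S) (L : List (Finset (S × S))) (a : S × S → Bool)
    (p : S × S) :
    answersFrom r L a p = true ↔
      ((∃ Q ∈ L, p ∈ Q) ∧ r p.1 p.2) ∨ ((¬ ∃ Q ∈ L, p ∈ Q) ∧ a p = true) := by
  classical
  induction L generalizing a with
  | nil => simp [answersFrom]
  | cons Q L ih =>
    rw [answersFrom, ih]
    by_cases h1 : p ∈ Q <;> by_cases h2 : ∃ Q ∈ L, p ∈ Q <;> simp [h1, h2]

theorem answersFrom_false_eq_true_iff (r : Setoid S) (L : List (Finset (S × S))) (x y : S) :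
    answersFrom r L (fun _ => false) (x, y) = true ↔ (∃ Q ∈ L, (x, y) ∈ Q) ∧ r x y := by
  simp [answersFrom_eq_true_iff]

/-- The processor bound `Fintype.card S` is automatic, because the first components of the tests
of an exclusive-read round are distinct. -/
theorem isExclusiveRound_card [Fintype S] {Q : Finset (S × S)} (hne : ∀ q ∈ Q, q.1 ≠ q.2)
    (h : ∀ q ∈ Q, ∀ q' ∈ Q, ∀ x : S, (x = q.1 ∨ x = q.2) → (x = q'.1 ∨ x = q'.2) → q = q') :
    IsExclusiveRound (Fintype.card S) Q := by
  refine ⟨?_, hne, h⟩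
  have hinj : Set.InjOn Prod.fst (Q : Set (S × S)) := fun q hq q' hq' e =>
    h q hq q' hq' q.1 (Or.inl rfl) (Or.inl e)
  exact Finset.card_le_card_of_injOn Prod.fst (fun _ _ => Finset.mem_univ _) hinj

end Algorithm

/-! ### Scheduling tests in exclusive-read rounds -/

section Scheduling

open Algorithm

variable {S : Type*} [Fintype S]

/-- A permutation has a colouring with three colours under which no moved point has the colour of its
image. The points are coloured greedily: each has at most two neighbours. -/
theorem exists_three_colouring (π : Equiv.Perm S) :
    ∃ c : S → Fin 3, ∀ x, π x ≠ x → c x ≠ c (π x) := by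
  classical
  suffices H : ∀ T : Finset S, ∃ c : S → Fin 3, ∀ x ∈ T, π x ∈ T → π x ≠ x → c x ≠ c (π x) by
    obtain ⟨c, hc⟩ := H univ
    exact ⟨c, fun x => hc x (mem_univ _) (mem_univ _)⟩
  intro T
  induction T using Finset.induction_on with
  | empty => exact ⟨fun _ => 0, by simp⟩
  | insert a T ha ih =>
    obtain ⟨c, hc⟩ := ih
    have avoid : ∀ i j : Fin 3, ∃ k, k ≠ i ∧ k ≠ j := by decide
    obtain ⟨k, hk1, hk2⟩ := avoid (c (π a)) (c (π.symm a))
    refine ⟨Function.update c a k, fun x hx hpx hne => ?_⟩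
    by_cases hxa : x = a
    · subst hxa
      rw [Function.update_self, Function.update_of_ne hne]
      exact hk1
    · by_cases hpa : π x = a
      · have hxs : π.symm a = x := by rw [← hpa, Equiv.symm_apply_apply]
        rw [hpa, Function.update_self, Function.update_of_ne hxa, ← hxs]
        exact hk2.symm
      · rw [Function.update_of_ne hxa, Function.update_of_ne hpa]
        exact hc x (mem_of_mem_insert_of_ne hx hxa) (mem_of_mem_insert_of_ne hpx hpa) hne

theorem exists_rounds_of_perm (π : Equiv.Perm S) :
    ∃ L : List (Finset (S × S)), L.length ≤ 3 ∧
      (∀ Q ∈ L, IsExclusiveRound (Fintype.card S) Q) ∧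
      ∀ x, π x ≠ x → ∃ Q ∈ L, (x, π x) ∈ Q := by
  classical
  obtain ⟨c, hc⟩ := exists_three_colouring π
  refine ⟨(List.finRange 3).map fun i =>
    univ.filter fun p : S × S => p.2 = π p.1 ∧ p.2 ≠ p.1 ∧ c p.1 = i, by simp, ?_, ?_⟩
  · intro Q hQ
    obtain ⟨i, -, rfl⟩ := List.mem_map.1 hQ
    refine isExclusiveRound_card ?_ ?_
    · intro q hq
      exact (mem_filter.1 hq).2.2.1.symm
    · rintro ⟨x, y⟩ hq ⟨x', y'⟩ hq' z hz hz'
      simp only [mem_filter, mem_univ, true_and] at hq hq' hz hz'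
      obtain ⟨rfl, hne, hi⟩ := hq
      obtain ⟨rfl, hne', hi'⟩ := hq'
      have key : x = x' := by
        rcases hz with rfl | rfl <;> rcases hz' with h | h
        · exact h
        · subst h
          exact absurd (hi'.trans hi.symm) (hc x' hne')
        · subst h
          exact absurd (hi.trans hi'.symm) (hc x hne)
        · exact π.injective h
      rw [key]
  · intro x hx
    exact ⟨_, List.mem_map.2 ⟨c x, List.mem_finRange _, rfl⟩, by simp [hx]⟩

/-- An injection of `S` into `C × Fin K` tells every element outside `C` its partner in `C` and its round. -/
theorem exists_rounds_of_finset (C : Finset S) (K : ℕ) (hC : Fintype.card S ≤ K * #C) :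
    ∃ Q : Fin K → Finset (S × S), (∀ j, IsExclusiveRound (Fintype.card S) (Q j)) ∧
      ∀ x ∉ C, ∃ j, ∃ y ∈ C, (x, y) ∈ Q j := by
  classical
  obtain ⟨e⟩ : Nonempty (S ↪ {y // y ∈ C} × Fin K) := by
    apply Function.Embedding.nonempty_of_card_le
    simpa [mul_comm] using hC
  refine ⟨fun j => univ.filter fun p : S × S => p.1 ∉ C ∧ ((e p.1).1 : S) = p.2 ∧ (e p.1).2 = j,
    fun j => isExclusiveRound_card ?_ ?_, ?_⟩
  · rintro ⟨x, y⟩ hq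
    simp only [mem_filter, mem_univ, true_and] at hq
    obtain ⟨hx, rfl, -⟩ := hq
    exact fun h => hx ((show x = (e x).1 from h) ▸ (e x).1.2)
  · rintro ⟨x, y⟩ hq ⟨x', y'⟩ hq' z hz hz'
    simp only [mem_filter, mem_univ, true_and] at hq hq' hz hz'
    obtain ⟨hx, rfl, hj⟩ := hq
    obtain ⟨hx', rfl, hj'⟩ := hq'
    have key : x = x' := by
      rcases hz with rfl | rfl <;> rcases hz' with h | h
      · exact h
      · exact absurd (h ▸ (e x').1.2) hx
      · exact absurd (h ▸ (e x).1.2) hx'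
      · exact e.injective (Prod.ext (Subtype.ext h) (hj.trans hj'.symm))
    rw [key]
  · intro x hx
    exact ⟨(e x).2, (e x).1, (e x).1.2, by simp [hx]⟩

open Classical in
theorem card_large_classes_le (s : Setoid S) (K : ℕ) :
    #{q : Quotient s | Fintype.card S ≤ K * #{x : S | Quotient.mk s x = q}} ≤ K := by
  rcases isEmpty_or_nonempty S with hS | hS
  · have : IsEmpty (Quotient s) := ⟨fun q => q.inductionOn fun x => hS.elim x⟩
    simp [Finset.univ_eq_empty]
  · set T : Finset (Quotient s) :=
      {q : Quotient s | Fintype.card S ≤ K * #{x : S | Quotient.mk s x = q}} with hT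
    have h1 : #T * Fintype.card S ≤ ∑ q ∈ T, K * #{x : S | Quotient.mk s x = q} := by
      rw [← smul_eq_mul]
      exact Finset.card_nsmul_le_sum _ _ _ fun q hq => (mem_filter.1 hq).2
    have h2 : ∑ q ∈ T, #{x : S | Quotient.mk s x = q} ≤ Fintype.card S := by
      calc ∑ q ∈ T, #{x : S | Quotient.mk s x = q}
          ≤ ∑ q : Quotient s, #{x : S | Quotient.mk s x = q} :=
            Finset.sum_le_sum_of_subset (Finset.subset_univ T)
        _ = Fintype.card S :=
            (Finset.card_eq_sum_card_fiberwise fun x _ => Finset.mem_univ (Quotient.mk s x)).symm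
    rw [← Finset.mul_sum] at h1
    exact Nat.le_of_mul_le_mul_right (h1.trans (Nat.mul_le_mul_left K h2)) Fintype.card_pos

open Classical in
theorem exists_rounds_of_setoid (s : Setoid S) (K : ℕ) :
    ∃ L : List (Finset (S × S)), L.length ≤ K * K ∧
      (∀ Q ∈ L, IsExclusiveRound (Fintype.card S) Q) ∧
      ∀ z, Fintype.card S ≤ K * #{y : S | s y z} → ∀ x, s x z ∨ ∃ y, s y z ∧ ∃ Q ∈ L, (x, y) ∈ Q := by
  set T : Finset (Quotient s) :=
    {q : Quotient s | Fintype.card S ≤ K * #{x : S | Quotient.mk s x = q}} with hT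
  have hex : ∀ q : T, ∃ Q : Fin K → Finset (S × S),
      (∀ j, IsExclusiveRound (Fintype.card S) (Q j)) ∧
      ∀ x ∉ ({x : S | Quotient.mk s x = q} : Finset S),
        ∃ j, ∃ y ∈ ({x : S | Quotient.mk s x = q} : Finset S), (x, y) ∈ Q j := fun q =>
    exists_rounds_of_finset _ K (mem_filter.1 q.2).2
  choose Q hQ hcover using hex
  refine ⟨(univ : Finset (T × Fin K)).toList.map fun t => Q t.1 t.2, ?_, ?_, ?_⟩
  · simpa using Nat.mul_le_mul_right K (card_large_classes_le s K)
  · intro Q' hQ'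
    obtain ⟨t, -, rfl⟩ := List.mem_map.1 hQ'
    exact hQ _ _
  · intro z hz x
    have hmk : ∀ y, Quotient.mk s y = Quotient.mk s z ↔ s y z := fun y => Quotient.eq
    by_cases hx : s x z
    · exact Or.inl hx
    · have hzT : Quotient.mk s z ∈ T := by simpa [hT, hmk] using hz
      obtain ⟨j, y, hy, hxy⟩ := hcover ⟨_, hzT⟩ x (by simpa [hmk] using hx)
      refine Or.inr ⟨y, by simpa [hmk] using hy, _, List.mem_map.2 ⟨(⟨_, hzT⟩, j), ?_, rfl⟩, hxy⟩
      simp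

end Scheduling

/-! ### Expanding tuples of permutations -/

section Expansion

variable {S : Type*} [Fintype S]

/-- Any two sets with at least `t` elements each are joined by an edge `x ↦ π i x`. -/
def Expanding {ι : Type*} (t : ℝ) (π : ι → Equiv.Perm S) : Prop :=
  ∀ A B : Finset S, t ≤ #A → t ≤ #B → ∃ i, ∃ x ∈ A, π i x ∈ B

open Classical in
/-- A set `W` closed under `s` contains a class of `s` with a third of its elements, provided that
no two disjoint sets of this size can be separated by classes of `s`. -/
theorem exists_large_class (s : Setoid S) (W : Finset S) (hW : W.Nonempty)
    (hWs : ∀ x y, s x y → x ∈ W → y ∈ W)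
    (hconn : ∀ A B : Finset S, A ⊆ W → B ⊆ W → Disjoint A B → #W ≤ 3 * #A → #W ≤ 3 * #B →
      ∃ x ∈ A, ∃ y ∈ B, s x y) :
    ∃ z ∈ W, #W ≤ 3 * #{y : S | s y z} := by
  let P : Finset (Finset S) :=
    W.powerset.filter fun U => (∀ x y, s x y → x ∈ U → y ∈ U) ∧ #W ≤ 3 * #U
  have hWP : W ∈ P := by
    simp only [P, mem_filter, mem_powerset, subset_refl, true_and]
    exact ⟨hWs, by omega⟩
  obtain ⟨U, hU, hmin⟩ := P.exists_min_image Finset.card ⟨W, hWP⟩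
  obtain ⟨hUW, hUs, hUc⟩ : U ⊆ W ∧ (∀ x y, s x y → x ∈ U → y ∈ U) ∧ #W ≤ 3 * #U := by
    simpa [P] using hU
  have hWpos := hW.card_pos
  obtain ⟨z, hz⟩ : U.Nonempty := Finset.card_pos.1 (by omega)
  refine ⟨z, hUW hz, ?_⟩
  by_contra! hsmall
  set C : Finset S := {y : S | s y z} with hC
  have hCmem : ∀ y, y ∈ C ↔ s y z := by simp [hC]
  have hCU : C ⊆ U := fun y hy => hUs z y (s.symm ((hCmem y).1 hy)) hz
  have hzC : z ∈ C := (hCmem z).2 (s.refl z)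
  -- Removing the class of `z` from `U` leaves fewer than `#W / 3` elements, by minimality.
  have hdiff : 3 * #(U \ C) < #W := by
    by_contra! hge
    have hmem : U \ C ∈ P := by
      simp only [P, mem_filter, mem_powerset]
      refine ⟨sdiff_subset.trans hUW, fun x y hxy hx => ?_, hge⟩
      rw [mem_sdiff] at hx ⊢
      exact ⟨hUs x y hxy hx.1, fun hy => hx.2 ((hCmem x).2 (s.trans hxy ((hCmem y).1 hy)))⟩
    have := hmin _ hmem
    have := Finset.card_lt_card
      (Finset.ssubset_iff_subset_ne.2 ⟨sdiff_subset, fun h => (mem_sdiff.1 (h ▸ hz)).2 hzC⟩ :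
        U \ C ⊂ U)
    omega
  have h1 := Finset.card_sdiff_add_card_eq_card hCU
  have h2 := Finset.card_sdiff_add_card_eq_card hUW
  obtain ⟨x, hx, y, hy, hxy⟩ :=
    hconn U (W \ U) hUW sdiff_subset disjoint_sdiff hUc (by omega)
  exact (mem_sdiff.1 hy).2 (hUs x y hxy hx)

open Classical in
/-- Given that `π` maps `A` off `B`, a further point `a` is mapped off `B` with probability at most
`1 - #B / n`: composing with a transposition shows that every value in `B` is at least as likely
for `π a` as any other value. -/
theorem card_avoiding_insert (A B : Finset S) (a : S) (ha : a ∉ A) :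
    Fintype.card S * #{π : Equiv.Perm S | ∀ x ∈ insert a A, π x ∉ B} ≤
      (Fintype.card S - #B) * #{π : Equiv.Perm S | ∀ x ∈ A, π x ∉ B} := by
  set P : Finset (Equiv.Perm S) := {π : Equiv.Perm S | ∀ x ∈ A, π x ∉ B} with hP
  let M : S → ℕ := fun y => #{π ∈ P | π a = y}
  have hM : ∀ y, ∀ z ∈ B, M y ≤ M z := by
    intro y z hz
    refine Finset.card_le_card_of_injOn (fun π => Equiv.swap y z * π) ?_ ?_
    · intro π hπ
      simp only [hP, mem_coe, mem_filter, mem_univ, true_and] at hπ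
      simp only [hP, mem_coe, mem_filter, mem_univ, true_and, Equiv.Perm.mul_apply]
      obtain ⟨hA, rfl⟩ := hπ
      refine ⟨fun x hx => ?_, Equiv.swap_apply_left _ _⟩
      rw [Equiv.swap_apply_of_ne_of_ne]
      · exact hA x hx
      · exact fun h => ha (π.injective h ▸ hx)
      · exact fun h => hA x hx (h ▸ hz)
    · intro π _ π' _ h
      exact mul_left_cancel h
  have htotal : #P = ∑ y ∈ Bᶜ, M y + ∑ y ∈ B, M y := by
    rw [Finset.sum_compl_add_sum]
    exact Finset.card_eq_sum_card_fiberwise fun π _ => Finset.mem_univ (π a)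
  have hins : #{π : Equiv.Perm S | ∀ x ∈ insert a A, π x ∉ B} = ∑ y ∈ Bᶜ, M y := by
    have hmaps : ∀ π ∈ ({π : Equiv.Perm S | ∀ x ∈ insert a A, π x ∉ B} : Finset _), π a ∈ Bᶜ := by
      intro π hπ
      simp only [mem_filter, mem_univ, true_and] at hπ
      exact mem_compl.2 (hπ a (mem_insert_self _ _))
    rw [Finset.card_eq_sum_card_fiberwise hmaps]
    refine Finset.sum_congr rfl fun y hy => ?_
    congr 1
    ext π
    simp only [hP, mem_filter, mem_univ, true_and, forall_mem_insert]
    constructor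
    · rintro ⟨⟨-, h⟩, e⟩
      exact ⟨h, e⟩
    · rintro ⟨h, e⟩
      exact ⟨⟨e ▸ mem_compl.1 hy, h⟩, e⟩
  have hcross : #B * ∑ y ∈ Bᶜ, M y ≤ #Bᶜ * ∑ z ∈ B, M z := by
    calc #B * ∑ y ∈ Bᶜ, M y = ∑ z ∈ B, ∑ y ∈ Bᶜ, M y := by simp
      _ ≤ ∑ z ∈ B, ∑ y ∈ Bᶜ, M z :=
        Finset.sum_le_sum fun z hz => Finset.sum_le_sum fun y _ => hM y z hz
      _ = #Bᶜ * ∑ z ∈ B, M z := by simp [Finset.mul_sum]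
  have hcard : Fintype.card S = #Bᶜ + #B := (Finset.card_compl_add_card B).symm
  rw [hins, htotal, ← Finset.card_compl, hcard]
  nlinarith

open Classical in
theorem card_avoiding_mul_le (A B : Finset S) :
    Fintype.card S ^ #A * #{π : Equiv.Perm S | ∀ x ∈ A, π x ∉ B} ≤
      (Fintype.card S - #B) ^ #A * Fintype.card (Equiv.Perm S) := by
  induction A using Finset.induction_on with
  | empty => simp
  | insert a A ha ih =>
    rw [Finset.card_insert_of_notMem ha, pow_succ, pow_succ]
    calc _ = Fintype.card S ^ #A *
          (Fintype.card S * #{π : Equiv.Perm S | ∀ x ∈ insert a A, π x ∉ B}) := by ring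
      _ ≤ Fintype.card S ^ #A *
          ((Fintype.card S - #B) * #{π : Equiv.Perm S | ∀ x ∈ A, π x ∉ B}) :=
        Nat.mul_le_mul_left _ (card_avoiding_insert A B a ha)
      _ = (Fintype.card S - #B) *
          (Fintype.card S ^ #A * #{π : Equiv.Perm S | ∀ x ∈ A, π x ∉ B}) := by ring
      _ ≤ (Fintype.card S - #B) *
          ((Fintype.card S - #B) ^ #A * Fintype.card (Equiv.Perm S)) := Nat.mul_le_mul_left _ ih
      _ = _ := by ring

open Classical in
theorem card_avoiding_le_exp [Nonempty S] {ε : ℝ} (hε : 0 ≤ ε) (A B : Finset S)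
    (hA : ε * Fintype.card S ≤ #A) (hB : ε * Fintype.card S ≤ #B) :
    (#{π : Equiv.Perm S | ∀ x ∈ A, π x ∉ B} : ℝ) ≤
      Real.exp (-(ε ^ 2 * Fintype.card S)) * Fintype.card (Equiv.Perm S) := by
  have hn : (0 : ℝ) < Fintype.card S := by exact_mod_cast Fintype.card_pos
  have h := card_avoiding_mul_le A B
  have h' : (Fintype.card S : ℝ) ^ #A * #{π : Equiv.Perm S | ∀ x ∈ A, π x ∉ B} ≤
      ((Fintype.card S : ℝ) - #B) ^ #A * Fintype.card (Equiv.Perm S) := by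
    rw [← Nat.cast_sub (Finset.card_le_univ B)]
    exact_mod_cast h
  have hbase : (Fintype.card S : ℝ) - #B ≤ Fintype.card S * Real.exp (-ε) := by
    nlinarith [Real.add_one_le_exp (-ε)]
  have hbase0 : (0 : ℝ) ≤ (Fintype.card S : ℝ) - #B :=
    sub_nonneg.2 (by exact_mod_cast Finset.card_le_univ B)
  have hexp : Real.exp (-ε) ^ #A ≤ Real.exp (-(ε ^ 2 * Fintype.card S)) := by
    rw [← Real.exp_nat_mul, Real.exp_le_exp]
    nlinarith
  have hpow : ((Fintype.card S : ℝ) - #B) ^ #A ≤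
      (Fintype.card S : ℝ) ^ #A * Real.exp (-(ε ^ 2 * Fintype.card S)) :=
    calc _ ≤ (Fintype.card S * Real.exp (-ε)) ^ #A := pow_le_pow_left₀ hbase0 hbase _
      _ = (Fintype.card S : ℝ) ^ #A * Real.exp (-ε) ^ #A := mul_pow _ _ _
      _ ≤ _ := by gcongr
  refine le_of_mul_le_mul_left (h'.trans ?_) (pow_pos hn #A)
  calc _ ≤ (Fintype.card S : ℝ) ^ #A * Real.exp (-(ε ^ 2 * Fintype.card S)) *
        Fintype.card (Equiv.Perm S) := by gcongr
    _ = _ := by ring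

open Classical in
theorem card_not_expanding_le [Nonempty S] {ε : ℝ} (hε : 0 ≤ ε) (d : ℕ) (hd : 3 ≤ d * ε ^ 2) :
    (#{π : Fin d → Equiv.Perm S | ¬ Expanding (ε * Fintype.card S) π} : ℝ) ≤
      Real.exp (-(Fintype.card S : ℝ)) * Fintype.card (Fin d → Equiv.Perm S) := by
  set n := Fintype.card S with hn
  let pairs : Finset (Finset S × Finset S) :=
    {p : Finset S × Finset S | ε * n ≤ #p.1 ∧ ε * n ≤ #p.2}
  let bad : Finset S × Finset S → Finset (Fin d → Equiv.Perm S) := fun p =>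
    Fintype.piFinset fun _ => {π : Equiv.Perm S | ∀ x ∈ p.1, π x ∉ p.2}
  have hsub : ({π : Fin d → Equiv.Perm S | ¬ Expanding (ε * n) π} : Finset _) ⊆
      pairs.biUnion bad := by
    intro π hπ
    have hπ' : ¬ Expanding (ε * n) π := (mem_filter.1 hπ).2
    simp only [Expanding] at hπ'
    push Not at hπ'
    obtain ⟨A, B, hA, hB, h⟩ := hπ'
    refine mem_biUnion.2 ⟨(A, B), ?_, ?_⟩
    · simp [pairs, hA, hB]
    · simpa [bad] using h
  have hbad : ∀ p ∈ pairs, (#(bad p) : ℝ) ≤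
      Real.exp (-(3 * n)) * Fintype.card (Fin d → Equiv.Perm S) := by
    intro p hp
    simp only [pairs, mem_filter, mem_univ, true_and] at hp
    have h := card_avoiding_le_exp hε p.1 p.2 hp.1 hp.2
    have hexp : Real.exp (-(ε ^ 2 * n)) ^ d ≤ Real.exp (-(3 * n)) := by
      rw [← Real.exp_nat_mul, Real.exp_le_exp]
      nlinarith [Nat.cast_nonneg (α := ℝ) n]
    simp only [bad, Fintype.card_piFinset_const, Fintype.card_fun, Fintype.card_fin, Nat.cast_pow]
    calc _ ≤ (Real.exp (-(ε ^ 2 * n)) * Fintype.card (Equiv.Perm S)) ^ d :=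
          pow_le_pow_left₀ (Nat.cast_nonneg _) h d
      _ = Real.exp (-(ε ^ 2 * n)) ^ d * (Fintype.card (Equiv.Perm S) : ℝ) ^ d := mul_pow _ _ _
      _ ≤ _ := by gcongr
  have hpairs : (#pairs : ℝ) ≤ 4 ^ n := by
    have : #pairs ≤ 2 ^ n * 2 ^ n := by
      refine (Finset.card_le_univ pairs).trans ?_
      simp [hn]
    rw [← mul_pow] at this
    exact_mod_cast this
  have hfour : (4 : ℝ) ^ n ≤ Real.exp (2 * n) := by
    have h4 : (4 : ℝ) ≤ Real.exp 2 := by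
      have : Real.exp 2 = Real.exp 1 * Real.exp 1 := by rw [← Real.exp_add]; norm_num
      nlinarith [Real.add_one_le_exp 1]
    rw [mul_comm, Real.exp_nat_mul]
    exact pow_le_pow_left₀ (by norm_num) h4 n
  calc (#{π : Fin d → Equiv.Perm S | ¬ Expanding (ε * n) π} : ℝ)
      ≤ ∑ p ∈ pairs, (#(bad p) : ℝ) := by
        exact_mod_cast (Finset.card_le_card hsub).trans Finset.card_biUnion_le
    _ ≤ #pairs * (Real.exp (-(3 * n)) * Fintype.card (Fin d → Equiv.Perm S)) := by
        rw [← nsmul_eq_mul]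
        exact Finset.sum_le_card_nsmul _ _ _ hbad
    _ ≤ Real.exp (2 * n) * (Real.exp (-(3 * n)) * Fintype.card (Fin d → Equiv.Perm S)) := by
        gcongr
        exact hpairs.trans hfour
    _ = Real.exp (-(n : ℝ)) * Fintype.card (Fin d → Equiv.Perm S) := by
        rw [← mul_assoc, ← Real.exp_add]
        ring_nf

theorem one_sub_exp_le_expanding {ε : ℝ} (hε : 0 ≤ ε) (d : ℕ) (hd : 3 ≤ d * ε ^ 2) :
    ENNReal.ofReal (1 - Real.exp (-(Fintype.card S : ℝ))) ≤
      (letI := Classical.decEq S; PMF.uniformOfFintype (Fin d → Equiv.Perm S)).toOuterMeasure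
        {π | Expanding (ε * Fintype.card S) π} := by
  classical
  rcases isEmpty_or_nonempty S with hS | hS
  · simp
  · have hbad := card_not_expanding_le (S := S) hε d hd
    have hsum : (#{π : Fin d → Equiv.Perm S | Expanding (ε * Fintype.card S) π} : ℝ) +
        #{π : Fin d → Equiv.Perm S | ¬ Expanding (ε * Fintype.card S) π} =
          Fintype.card (Fin d → Equiv.Perm S) := by
      exact_mod_cast Finset.card_filter_add_card_filter_not (s := univ)
        fun π : Fin d → Equiv.Perm S => Expanding (ε * Fintype.card S) π
    have hN : (0 : ℝ) < Fintype.card (Fin d → Equiv.Perm S) := by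
      exact_mod_cast Fintype.card_pos
    rw [PMF.toOuterMeasure_uniformOfFintype_apply]
    have hcard : Fintype.card {π : Fin d → Equiv.Perm S | Expanding (ε * Fintype.card S) π} =
        #{π : Fin d → Equiv.Perm S | Expanding (ε * Fintype.card S) π} := by
      simp [Fintype.card_subtype]
    refine ENNReal.ofReal_le_of_le_toReal ?_
    rw [ENNReal.toReal_div, ENNReal.toReal_natCast, ENNReal.toReal_natCast, le_div_iff₀ ?_]
    · rw [hcard]
      linarith
    · exact hN

end Expansion

/-! ### Correctness of the two-phase algorithm -/

section Correctness

variable {S : Type*} [Fintype S]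

open Classical in
theorem exists_large_class_of_expanding {ι : Type*} {lam : ℝ} (hpos : 0 < lam)
    {π : ι → Equiv.Perm S} (hπ : Expanding (lam / 3 * Fintype.card S) π)
    {r s : Setoid S} (hr : SmallestClassAtLeast r (lam * Fintype.card S)) (hsr : s ≤ r)
    (hs : ∀ i x, π i x ≠ x → r x (π i x) → s x (π i x)) (K : ℕ) (hK : 3 / lam ≤ K) (w : S) :
    ∃ z, r z w ∧ Fintype.card S ≤ K * #{y : S | s y z} := by
  set W : Finset S := {y : S | r y w} with hW
  have hWmem : ∀ y, y ∈ W ↔ r y w := by simp [hW]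
  have hWcard : lam * Fintype.card S ≤ #W := by
    have h := hr {y | r y w} (Setoid.mem_classes r w)
    rwa [show ({y | r y w} : Set S) = (W : Set S) by ext; simp [hW], Set.ncard_coe_finset] at h
  obtain ⟨z, hz, hbig⟩ := exists_large_class s W ⟨w, (hWmem w).2 (r.refl w)⟩
    (fun x y hxy hx => (hWmem y).2 (r.trans (r.symm (hsr hxy)) ((hWmem x).1 hx))) <| by
      intro A B hA hB hAB hAc hBc
      have hAc' : (#W : ℝ) ≤ 3 * #A := by exact_mod_cast hAc
      have hBc' : (#W : ℝ) ≤ 3 * #B := by exact_mod_cast hBc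
      obtain ⟨i, x, hx, hy⟩ := hπ A B (by linarith) (by linarith)
      refine ⟨x, hx, π i x, hy, hs i x ?_ ?_⟩
      · exact fun h => Finset.disjoint_left.1 hAB hx (h ▸ hy)
      · exact r.trans ((hWmem x).1 (hA hx)) (r.symm ((hWmem _).1 (hB hy)))
  refine ⟨z, (hWmem z).1 hz, ?_⟩
  have hbig' : (#W : ℝ) ≤ 3 * #{y : S | s y z} := by exact_mod_cast hbig
  have hK' : 3 ≤ K * lam := (div_le_iff₀ hpos).1 hK
  have hc : (0 : ℝ) ≤ #{y : S | s y z} := Nat.cast_nonneg _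
  have hreal : (Fintype.card S : ℝ) ≤ K * #{y : S | s y z} := by
    refine le_of_mul_le_mul_left ?_ hpos
    nlinarith
  exact_mod_cast hreal

open Algorithm in
/-- The two-phase algorithm for a fixed tuple of permutations. -/
theorem exists_algorithm_of_perms {lam : ℝ} (hpos : 0 < lam) (d K : ℕ) (hK : 3 / lam ≤ K)
    (π : Fin d → Equiv.Perm S) :
    ∃ A : Algorithm S, A.IsExclusiveRead (Fintype.card S) ∧
      (∀ r, A.rounds r ≤ K * K + d * 3) ∧
      (Expanding (lam / 3 * Fintype.card S) π →
        ∀ r, SmallestClassAtLeast r (lam * Fintype.card S) → A.Sorts r) := by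
  classical
  choose P hPlen hPex hPcover using exists_rounds_of_perm (S := S)
  choose L hLlen hLex hLcover using fun s : Setoid S => exists_rounds_of_setoid s K
  let L₁ : List (Finset (S × S)) := (List.ofFn π).flatMap P
  let gen : (S × S → Bool) → Setoid S := fun a => Relation.EqvGen.setoid fun x y => a (x, y) = true
  let phase₂ : (S × S → Bool) → Algorithm S := fun a =>
    performRounds (fun b => output (gen a ⊔ gen b)) (L (gen a)) fun _ => false
  refine ⟨performRounds phase₂ L₁ fun _ => false, ?_, fun r => ?_, fun hπ r hr => ?_⟩
  · refine isExclusiveRead_performRounds (fun a => ?_) (fun Q hQ => ?_) _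
    · exact isExclusiveRead_performRounds (fun b => by trivial) (hLex _) _
    · obtain ⟨σ, -, hσ⟩ := List.mem_flatMap.1 hQ
      exact hPex σ Q hσ
  · have h₁ : L₁.length ≤ d * 3 := by
      have := List.sum_le_card_nsmul ((List.ofFn π).map fun σ => (P σ).length) 3 (by
        intro m hm
        obtain ⟨σ, -, rfl⟩ := List.mem_map.1 hm
        exact hPlen σ)
      simpa [L₁, List.length_flatMap] using this
    simp only [phase₂, rounds_performRounds, rounds, zero_add]
    exact Nat.add_le_add (hLlen _) h₁
  · rw [Sorts, run_performRounds, run_performRounds]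
    set a := answersFrom r L₁ fun _ => false with ha
    set s := gen a with hs
    set b := answersFrom r (L s) fun _ => false with hb
    have gen_le : ∀ M, gen (answersFrom r M fun _ => false) ≤ r := fun M =>
      Setoid.eqvGen_le fun x y hxy => ((answersFrom_false_eq_true_iff r M x y).1 hxy).2
    have gen_of : ∀ c x y, c (x, y) = true → gen c x y := fun c x y h => Relation.EqvGen.rel x y h
    change s ⊔ gen b = r
    refine le_antisymm (sup_le (gen_le _) (gen_le _)) ?_
    have hsr : s ≤ r := gen_le _
    have key : ∀ w, ∃ z, r z w ∧ Fintype.card S ≤ K * #{y : S | s y z} :=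
      exists_large_class_of_expanding hpos hπ hr hsr (fun i x hne hx => by
        obtain ⟨Q, hQ, hxQ⟩ := hPcover (π i) x hne
        refine gen_of a x _ ((answersFrom_false_eq_true_iff _ _ _ _).2 ⟨⟨Q, ?_, hxQ⟩, hx⟩)
        exact List.mem_flatMap.2 ⟨π i, (List.mem_ofFn' π _).2 ⟨i, rfl⟩, hQ⟩) K hK
    intro x w hxw
    obtain ⟨z, hzw, hz⟩ := key w
    have hjoin : ∀ x, r x z → (s ⊔ gen b) x z := by
      intro x hxz
      rcases hLcover s z hz x with h | ⟨y, hyz, hQ⟩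
      · exact le_sup_left (a := s) h
      · have hxy : r x y := r.trans hxz (r.symm (hsr hyz))
        exact (s ⊔ gen b).trans
          (le_sup_right (a := s)
            (gen_of b x y ((answersFrom_false_eq_true_iff _ _ _ _).2 ⟨hQ, hxy⟩)))
          (le_sup_left (a := s) hyz)
    exact (s ⊔ gen b).trans (hjoin x (r.trans hxw (r.symm hzw)))
      ((s ⊔ gen b).symm (hjoin w (r.symm hzw)))

end Correctness

end ECS

theorem mainTheorem3 (lam : ℝ) (hpos : 0 < lam) (hle : lam ≤ 0.4) :
    ∃ R : ℕ, ∀ (S : Type) [Fintype S],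
      ∃ A : ECS.RandomizedAlgorithm S,
        (∀ ω : A.Seed, (A.algorithm ω).IsExclusiveRead (Fintype.card S)) ∧
        (∀ (ω : A.Seed) (r : Setoid S), (A.algorithm ω).rounds r ≤ R) ∧
        ENNReal.ofReal (1 - Real.exp (-(Fintype.card S : ℝ))) ≤
          A.law.toOuterMeasure
            {ω : A.Seed | ∀ r : Setoid S,
              ECS.SmallestClassAtLeast r (lam * (Fintype.card S : ℝ)) →
                (A.algorithm ω).Sorts r} := by
  classical
  set d : ℕ := ⌈3 / (lam / 3) ^ 2⌉₊ with hd
  set K : ℕ := ⌈3 / lam⌉₊ with hK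
  have hd' : 3 ≤ d * (lam / 3) ^ 2 := (div_le_iff₀ (by positivity)).1 (Nat.le_ceil _)
  refine ⟨K * K + d * 3, fun S _ => ?_⟩
  choose alg hex hrounds hsorts using
    ECS.exists_algorithm_of_perms (S := S) hpos d K (Nat.le_ceil _)
  refine ⟨⟨Fin d → Equiv.Perm S,
    letI := Classical.decEq S; PMF.uniformOfFintype (Fin d → Equiv.Perm S), alg⟩, hex, hrounds, ?_⟩
  refine (ECS.one_sub_exp_le_expanding (S := S) (ε := lam / 3) (by positivity) d hd').trans ?_
  exact MeasureTheory.measure_mono fun π hπ => hsorts π hπ
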